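/- Let $\Gamma$ be the vertex set of a connected, locally finite graph without loops whose vertex degrees are bounded, and let $\operatorname{dist}$ be a metric on $\Gamma$. Let $a<b$, let $\mu$ be a probability measure on $[a,b]$ without atoms, and let $\mathbb P=\bigotimes_{x\in\Gamma}\mu$ on $\Omega=[a,b]^{\Gamma}$. For $\lambda>0$ and $\omega\in\Omega$ let $H_\omega=-\Delta+\lambda V_\omega$ be the Anderson model on $\ell^2(\Gamma)$, where $(-\Delta\psi)(x)=-\sum_{y\sim x}(\psi(y)-\psi(x))$ and $(V_\omega\psi)(x)=\omega_x\psi(x)$. Let $I\subset\mathbb R$ be an interval and suppose that dynamical localization holds on $I$: there are constants $c,C>0$ and $\zeta\in(0,1]$ such that for all $x,y\in\Gamma$ $$\mathbb E\Big(\sup_{t\in\mathbb R}\big|\langle\delta_y,e^{-itH_\omega}\chi_I(H_\omega)\delta_x\rangle\big|\Big)\le C e^{-c\,\operatorname{dist}(x,y)^\zeta}.$$ Suppose also that the volume of balls in $\Gamma$ grows subexponentially in $r^\zeta$: for all $x\in\Gamma$ and $\eta>0$ there is $A$ such that $|\{y:\operatorname{dist}(x,y)\le r\}|\le A e^{\eta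 r^\zeta}$ for all $r\ge 0$ (as is the case for $\Gamma=\mathbb Z^d$ with $\operatorname{dist}(x,y)=\|x-y\|_\infty$). Then for $\mathbb P$-almost every $\omega$ and every $\varepsilon>0$ there are positive constants $C_{\omega,\varepsilon,x_0}$, $x_0\in\Gamma$, such that every eigenfunction $\varphi\in\ell^2(\Gamma)$ of $H_\omega$ with eigenvalue in $I$ has a center of localization, i.e. a point $x_0$ with $|\varphi(x_0)|=\sup_{x}|\varphi(x)|$, and for each center of localization $x_0$ of $\varphi$ $$|\varphi(x)|\le C_{\omega,\varepsilon,x_0}\,\|\varphi\|\,e^{-(c-\varepsilon)\operatorname{dist}(x,x_0)^\zeta}\qquad\text{for all }x\in\Gamma.$$ -/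

import Mathlib

open MeasureTheory
open scoped ENNReal CompactlySupported

noncomputable section

namespace Anderson

/-- The Hilbert space `ℓ²(Γ)` of square-summable complex functions on `Γ`. -/
abbrev ell2 (Γ : Type*) := lp (fun _ : Γ => ℂ) 2

section Operators

variable {Γ : Type*}

/-- The canonical basis vector `δ_x`. -/
def delta (x : Γ) : ell2 Γ := by
  classical exact lp.single 2 x (1 : ℂ)

/-- Multiplication by a real function bounded by `M`, as a bounded operator on `ℓ²(Γ)`. -/
def mulOp (f : Γ → ℝ) (M : ℝ) (hM : ∀ x, |f x| ≤ M) : ell2 Γ →L[ℂ] ell2 Γ :=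
  have key : ∀ (ψ : ell2 Γ) (s : Finset Γ),
      ∑ x ∈ s, ‖(f x : ℂ) * ψ x‖ ^ (2 : ℝ≥0∞).toReal ≤ (|M| * ‖ψ‖) ^ (2 : ℝ≥0∞).toReal := by
    intro ψ s
    have h := lp.sum_rpow_le_norm_rpow (p := 2) (by simp) ψ s
    simp only [ENNReal.toReal_ofNat, Real.rpow_ofNat] at h ⊢
    calc ∑ x ∈ s, ‖(f x : ℂ) * ψ x‖ ^ 2 ≤ ∑ x ∈ s, M ^ 2 * ‖ψ x‖ ^ 2 := by
          refine Finset.sum_le_sum fun x _ => ?_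
          rw [norm_mul, mul_pow, Complex.norm_real, Real.norm_eq_abs]
          gcongr
          exact hM x
      _ = M ^ 2 * ∑ x ∈ s, ‖ψ x‖ ^ 2 := by rw [Finset.mul_sum]
      _ ≤ M ^ 2 * ‖ψ‖ ^ 2 := by gcongr
      _ = (|M| * ‖ψ‖) ^ 2 := by rw [mul_pow, sq_abs]
  LinearMap.mkContinuous
    { toFun := fun ψ => ⟨fun x => (f x : ℂ) * ψ x, memℓp_gen' (key ψ)⟩
      map_add' := fun ψ φ => Subtype.ext (funext fun x => mul_add (f x : ℂ) (ψ x) (φ x))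
      map_smul' := fun a ψ => by ext x; simp [mul_left_comm] }
    |M|
    fun ψ => lp.norm_le_of_forall_sum_le (by simp) (by positivity) (key ψ)

@[simp]
theorem mulOp_apply (f : Γ → ℝ) (M : ℝ) (hM : ∀ x, |f x| ≤ M) (ψ : ell2 Γ) (x : Γ) :
    mulOp f M hM ψ x = (f x : ℂ) * ψ x := rfl

variable (G : SimpleGraph Γ) [G.LocallyFinite] (K : ℕ) (hK : ∀ x, G.degree x ≤ K)

/-- The adjacency operator `(A ψ)(x) = ∑_{y ∼ x} ψ(y)` of a graph with degrees at most `K`. -/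
def adjOp : ell2 Γ →L[ℂ] ell2 Γ :=
  have key : ∀ (ψ : ell2 Γ) (s : Finset Γ),
      ∑ x ∈ s, ‖∑ y ∈ G.neighborFinset x, ψ y‖ ^ (2 : ℝ≥0∞).toReal
        ≤ ((K : ℝ) * ‖ψ‖) ^ (2 : ℝ≥0∞).toReal := by
    classical
    intro ψ s
    have h := lp.sum_rpow_le_norm_rpow (p := 2) (by simp) ψ (s.biUnion (fun x => G.neighborFinset x))
    simp only [ENNReal.toReal_ofNat, Real.rpow_ofNat] at h ⊢
    have h1 : ∀ x, ‖∑ y ∈ G.neighborFinset x, ψ y‖ ^ 2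
        ≤ K * ∑ y ∈ G.neighborFinset x, ‖ψ y‖ ^ 2 := fun x =>
      calc ‖∑ y ∈ G.neighborFinset x, ψ y‖ ^ 2
          ≤ (∑ y ∈ G.neighborFinset x, ‖ψ y‖) ^ 2 := by gcongr; exact norm_sum_le _ _
        _ ≤ (G.neighborFinset x).card * ∑ y ∈ G.neighborFinset x, ‖ψ y‖ ^ 2 :=
            sq_sum_le_card_mul_sum_sq
        _ ≤ K * ∑ y ∈ G.neighborFinset x, ‖ψ y‖ ^ 2 := by
            gcongr
            exact_mod_cast hK x
    calc ∑ x ∈ s, ‖∑ y ∈ G.neighborFinset x, ψ y‖ ^ 2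
        ≤ ∑ x ∈ s, (K : ℝ) * ∑ y ∈ G.neighborFinset x, ‖ψ y‖ ^ 2 :=
          Finset.sum_le_sum fun x _ => h1 x
      _ = K * ∑ x ∈ s, ∑ y ∈ G.neighborFinset x, ‖ψ y‖ ^ 2 := by rw [Finset.mul_sum]
      _ = K * ∑ y ∈ s.biUnion (fun x => G.neighborFinset x), ∑ x ∈ s with G.Adj x y, ‖ψ y‖ ^ 2 := by
          congr 1
          refine Finset.sum_comm' fun x y => ?_
          simp only [Finset.mem_filter, Finset.mem_biUnion, SimpleGraph.mem_neighborFinset]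
          constructor
          · rintro ⟨hx, hxy⟩; exact ⟨⟨hx, hxy⟩, x, hx, hxy⟩
          · rintro ⟨⟨hx, hxy⟩, -⟩; exact ⟨hx, hxy⟩
      _ ≤ K * ∑ y ∈ s.biUnion (fun x => G.neighborFinset x), K * ‖ψ y‖ ^ 2 := by
          gcongr with y hy
          rw [Finset.sum_const, nsmul_eq_mul]
          gcongr
          refine le_trans (Finset.card_le_card (t := G.neighborFinset y) ?_) (hK y)
          intro x hx
          simpa [G.adj_comm] using (Finset.mem_filter.mp hx).2
      _ = K ^ 2 * ∑ y ∈ s.biUnion (fun x => G.neighborFinset x), ‖ψ y‖ ^ 2 := by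
          rw [← Finset.mul_sum]; ring
      _ ≤ K ^ 2 * ‖ψ‖ ^ 2 := by gcongr
      _ = ((K : ℝ) * ‖ψ‖) ^ 2 := by rw [mul_pow]
  LinearMap.mkContinuous
    { toFun := fun ψ => ⟨fun x => ∑ y ∈ G.neighborFinset x, ψ y, memℓp_gen' (key ψ)⟩
      map_add' := fun ψ φ => Subtype.ext (funext fun x => Finset.sum_add_distrib (f := fun y => ψ y) (g := fun y => φ y))
      map_smul' := fun a ψ => by ext x; simp [Finset.mul_sum] }
    K
    fun ψ => lp.norm_le_of_forall_sum_le (by simp) (by positivity) (key ψ)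

@[simp]
theorem adjOp_apply (ψ : ell2 Γ) (x : Γ) :
    adjOp G K hK ψ x = ∑ y ∈ G.neighborFinset x, ψ y := rfl

/-- The negative discrete Laplacian `-Δ = deg - A`. -/
def negLaplacian : ell2 Γ →L[ℂ] ell2 Γ :=
  mulOp (fun x => (G.degree x : ℝ)) K (fun x => by simpa using hK x) - adjOp G K hK

theorem negLaplacian_apply (ψ : ell2 Γ) (x : Γ) :
    negLaplacian G K hK ψ x = -∑ y ∈ G.neighborFinset x, (ψ y - ψ x) := by
  have : negLaplacian G K hK ψ x = (G.degree x : ℂ) * ψ x - ∑ y ∈ G.neighborFinset x, ψ y := by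
    simp [negLaplacian]
  rw [this, Finset.sum_sub_distrib, Finset.sum_const, nsmul_eq_mul,
    SimpleGraph.card_neighborFinset_eq_degree]
  ring

/-- The Anderson potential `(V_ω ψ)(x) = ω_x ψ(x)`, for a configuration `ω ∈ [a,b]^Γ`. -/
def potential {a b : ℝ} (ω : Γ → Set.Icc a b) : ell2 Γ →L[ℂ] ell2 Γ :=
  mulOp (fun x => (ω x : ℝ)) (max |a| |b|) fun x => abs_le_max_abs_abs (ω x).2.1 (ω x).2.2

/-- The Anderson Hamiltonian `H_ω = -Δ + λ V_ω`, with `lam` for the disorder strength `λ`. -/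
def hamiltonian (lam : ℝ) {a b : ℝ} (ω : Γ → Set.Icc a b) : ell2 Γ →L[ℂ] ell2 Γ :=
  negLaplacian G K hK + (lam : ℂ) • potential ω

theorem mulOp_isSelfAdjoint (f : Γ → ℝ) (M : ℝ) (hM : ∀ x, |f x| ≤ M) :
    IsSelfAdjoint (mulOp f M hM) := by
  rw [ContinuousLinearMap.isSelfAdjoint_iff_isSymmetric]
  intro ψ φ
  simp only [ContinuousLinearMap.coe_coe, lp.inner_eq_tsum, mulOp_apply]
  refine tsum_congr fun x => ?_
  simp [mul_left_comm, mul_assoc]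

theorem delta_apply (x y : Γ) [Decidable (y = x)] :
    (delta x : ell2 Γ) y = if y = x then 1 else 0 := by
  classical
  simp only [delta, lp.coeFn_single, Pi.single_apply]
  congr

theorem inner_delta_left (x : Γ) (ψ : ell2 Γ) : inner ℂ (delta x) ψ = ψ x := by
  classical
  simp only [delta]
  rw [lp.inner_single_left]
  simp

theorem adjOp_isSelfAdjoint : IsSelfAdjoint (adjOp G K hK) := by
  classical
  rw [ContinuousLinearMap.isSelfAdjoint_iff']
  have hδ : ∀ x, adjOp G K hK (delta x) = ∑ y ∈ G.neighborFinset x, delta y := by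
    intro x
    ext z
    rw [adjOp_apply, lp.coeFn_sum, Finset.sum_apply]
    simp [delta_apply, G.adj_comm]
  ext ψ x
  rw [← inner_delta_left, ContinuousLinearMap.adjoint_inner_right, hδ, sum_inner, adjOp_apply]
  simp [inner_delta_left]

theorem hamiltonian_isSelfAdjoint (lam : ℝ) {a b : ℝ} (ω : Γ → Set.Icc a b) :
    IsSelfAdjoint (hamiltonian G K hK lam ω) := by
  refine ((mulOp_isSelfAdjoint _ _ _).sub (adjOp_isSelfAdjoint G K hK)).add ?_
  refine IsSelfAdjoint.smul ?_ (mulOp_isSelfAdjoint _ _ _)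
  simp [IsSelfAdjoint]

end Operators

section Spectral

variable {E : Type*} [NormedAddCommGroup E] [InnerProductSpace ℂ E] [CompleteSpace E]

/-- The positive functional `g ↦ ⟨ψ, g(H) ψ⟩` on real continuous functions with compact support,
where `g(H)` is given by the continuous functional calculus. -/
def spectralFunctional (H : E →L[ℂ] E) (ψ : E) : C_c(ℝ, ℝ) →ₚ[ℝ] ℝ :=
  PositiveLinearMap.mk₀
    { toFun := fun g => (inner ℂ ψ (cfc (fun s => g s) H ψ)).re
      map_add' := fun g₁ g₂ => by
        have := cfc_add (a := H) (fun s => g₁ s) (fun s => g₂ s)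
          g₁.continuous.continuousOn g₂.continuous.continuousOn
        simp only [CompactlySupportedContinuousMap.coe_add, Pi.add_apply]
        rw [this]
        simp
      map_smul' := fun r g => by
        have := cfc_smul (a := H) r (fun s => g s) g.continuous.continuousOn
        simp only [CompactlySupportedContinuousMap.coe_smul, Pi.smul_apply]
        rw [this]
        simp [inner_smul_right_eq_smul] }
    fun g hg => by
      have h : 0 ≤ cfc (fun s => g s) H := cfc_nonneg fun s _ => hg s
      rw [ContinuousLinearMap.nonneg_iff_isPositive] at h
      exact h.re_inner_nonneg_right ψ

/-- The spectral measure `μ_{H,ψ}` of a bounded self-adjoint operator `H` at the vector `ψ`: the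
Borel measure on `ℝ` with `⟨ψ, g(H) ψ⟩ = ∫ g dμ_{H,ψ}` for `g` continuous with compact support. -/
def spectralMeasure (H : E →L[ℂ] E) (ψ : E) : Measure ℝ :=
  RealRMK.rieszMeasure (spectralFunctional H ψ)

/-- The spectral projection `χ_I(H)` of a bounded self-adjoint operator `H` for a Borel set `I`:
the orthogonal projection onto the closed subspace of all `ψ` whose spectral measure is carried by
`I`. (These `ψ` form a closed subspace by the spectral theorem; `span` and `topologicalClosure` do
not enlarge it, they only make the definition independent of this fact.) -/
def spectralProjection (H : E →L[ℂ] E) (I : Set ℝ) : E →L[ℂ] E :=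
  (Submodule.span ℂ {ψ : E | spectralMeasure H ψ Iᶜ = 0}).topologicalClosure.starProjection

/-- The unitary group `e^{-itH}`. -/
def evolution (H : E →L[ℂ] E) (t : ℝ) : E →L[ℂ] E :=
  NormedSpace.exp ((-(Complex.I * t)) • H)

end Spectral

section Localization

variable {Γ : Type*}

/-- `sup_{t ∈ ℝ} |⟨δ_y, e^{-itH} χ_I(H) δ_x⟩|`; all these numbers are at most `1`. -/
def supAmplitude (H : ell2 Γ →L[ℂ] ell2 Γ) (I : Set ℝ) (x y : Γ) : ℝ :=
  ⨆ t : ℝ, ‖(inner ℂ (delta y) (evolution H t (spectralProjection H I (delta x))) : ℂ)‖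

/-- Dynamical localization in `I` with constants `c`, `C`, `ζ`, for a random bounded operator
`H : Ω → L(ℓ²(Γ))` over the probability space `(Ω, ℙ)`:
`𝔼 (sup_t |⟨δ_y, e^{-itH_ω} χ_I(H_ω) δ_x⟩|) ≤ C e^{-c dist(x,y)^ζ}` for all `x, y`. -/
def DynamicallyLocalized [Dist Γ] {Ω : Type*} [MeasurableSpace Ω] (ℙ : Measure Ω)
    (H : Ω → ell2 Γ →L[ℂ] ell2 Γ) (I : Set ℝ) (c C ζ : ℝ) : Prop :=
  ∀ x y : Γ, Integrable (fun ω => supAmplitude (H ω) I x y) ℙ ∧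
    ∫ ω, supAmplitude (H ω) I x y ∂ℙ ≤ C * Real.exp (-c * dist x y ^ ζ)

/-- `x₀` is a center of localization of `φ`: `|φ(x₀)| = sup_x |φ(x)|`. -/
def IsLocalizationCenter (φ : ell2 Γ) (x₀ : Γ) : Prop :=
  IsLUB (Set.range fun x => ‖φ x‖) ‖φ x₀‖

/-- The volume of balls grows subexponentially in `r^ζ`: for every `x` and `η > 0` there is `A`
such that `|B(x,r)| ≤ A e^{η r^ζ}` for all `r ≥ 0`. -/
def SubexponentialGrowth (Γ : Type*) [PseudoMetricSpace Γ] (ζ : ℝ) : Prop :=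
  ∀ x : Γ, ∀ η : ℝ, 0 < η → ∃ A : ℝ, ∀ r : ℝ, 0 ≤ r →
    (Metric.closedBall x r).Finite ∧
      ((Metric.closedBall x r).ncard : ℝ) ≤ A * Real.exp (η * r ^ ζ)

end Localization

end Anderson

end

open MeasureTheory Filter Topology
open scoped ENNReal CompactlySupported

namespace Anderson

/-! ### Spectral theory: eigenprojections controlled by the dynamics. -/

section SpectralTheory

variable {E : Type*} [NormedAddCommGroup E] [InnerProductSpace ℂ E] [CompleteSpace E]

/-! For a simple eigenvalue `e` in `I` with unit eigenvector `φ`, the eigenprojection has matrix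
elements of modulus `|φ x| |φ y|`. By the mean ergodic theorem it is a strong limit of averages of
`e^{-it(H-e)}`, so `|φ x| |φ y|` is at most `supAmplitude H I x y` (`norm_inner_mul_norm_inner_le`).
Simplicity of all eigenvalues holds almost surely, by a rank one perturbation argument
(`ae_simple_eigenvalues`).

Dynamical localization and subexponential growth make the amplitudes, weighted by `e^{(c-ε)
dist^ζ}`, summable in `y` almost surely (`DynamicallyLocalized.ae_tsum_ne_top`). At a center `x₀`
this gives decay of `|φ x₀| |φ y|`. It remains to divide by `|φ x₀|`, uniformly in `φ`: the summable
majorant forces half of the mass of `φ` into a finite set independent of `φ`, and `|φ|` is largest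
at `x₀`, so `|φ x₀|` is bounded below (`exists_norm_center_ge`). -/

/-- The continuous functional calculus acts on an eigenvector by evaluation at the eigenvalue. -/
theorem cfc_apply_of_eigenvector {H : E →L[ℂ] E} (hH : IsSelfAdjoint H) {e : ℝ} {φ : E}
    (hφ : H φ = (e : ℂ) • φ) (hφ0 : φ ≠ 0) (g : ℝ → ℝ) (hg : Continuous g) :
    cfc g H φ = (g e : ℂ) • φ := by
  have he : e ∈ spectrum ℝ H := by
    rw [spectrum.mem_iff]
    intro hu
    apply hφ0
    have h0 : (algebraMap ℝ (E →L[ℂ] E) e - H) φ = 0 := by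
      simp [Algebra.algebraMap_eq_smul_one, hφ]
    obtain ⟨u, hu⟩ := hu
    have h1 : ((↑u⁻¹ : E →L[ℂ] E) * ↑u) φ = 0 := by
      rw [hu, mul_apply_eq_comp, h0, map_zero]
    simpa using h1
  have key : ∀ f : C(spectrum ℝ H, ℝ), cfcHom hH f φ = (f ⟨e, he⟩ : ℂ) • φ := by
    intro f
    have hid : cfcHom hH (.restrict (spectrum ℝ H) <| .id ℝ) φ = (e : ℂ) • φ := by
      rw [cfcHom_id hH, hφ]
    -- Stone–Weierstrass: the `f` satisfying the claim form a closed subalgebra containing the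
    -- identity function.
    induction f using ContinuousMap.induction_on_of_compact with
    | const r =>
      have : (ContinuousMap.const (spectrum ℝ H) r) = algebraMap ℝ C(spectrum ℝ H, ℝ) r := rfl
      rw [this, AlgHomClass.commutes]
      simp [Algebra.algebraMap_eq_smul_one]
    | id => exact hid
    | star_id => rw [star_trivial]; exact hid
    | add f g hf hg => simp [hf, hg, add_smul]
    | mul f g hf hg => 
      rw [map_mul, mul_apply_eq_comp, hg, map_smul, hf, smul_smul, ContinuousMap.mul_apply,
        Complex.ofReal_mul, mul_comm]
    | frequently f hf =>
      have hcl : IsClosed {f : C(spectrum ℝ H, ℝ) | cfcHom hH f φ = (f ⟨e, he⟩ : ℂ) • φ} := by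
        refine isClosed_eq ?_ ?_
        · exact (ContinuousLinearMap.apply ℂ E φ).continuous.comp (cfcHom_continuous hH)
        · exact ((Complex.continuous_ofReal.comp (ContinuousEvalConst.continuous_eval_const _))).smul
            continuous_const
      exact hcl.mem_of_frequently_of_tendsto hf tendsto_id
  rw [cfc_apply g H hH hg.continuousOn, key]
  rfl

/-- The spectral measure of an eigenvector is a multiple of the Dirac measure at the eigenvalue. -/
theorem spectralMeasure_of_eigenvector {H : E →L[ℂ] E} (hH : IsSelfAdjoint H) {e : ℝ} {φ : E}
    (hφ : H φ = (e : ℂ) • φ) (hφ0 : φ ≠ 0) :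
    spectralMeasure H φ = ENNReal.ofReal (‖φ‖ ^ 2) • Measure.dirac e := by
  have : IsFiniteMeasure (ENNReal.ofReal (‖φ‖ ^ 2) • Measure.dirac e) :=
    Measure.smul_finite _ ENNReal.ofReal_ne_top
  have : (spectralMeasure H φ).Regular :=
    inferInstanceAs (RealRMK.rieszMeasure (spectralFunctional H φ)).Regular
  refine Measure.ext_of_integral_eq_on_compactlySupported fun f => ?_
  rw [spectralMeasure, RealRMK.integral_rieszMeasure, integral_smul_measure, integral_dirac]
  change (inner ℂ φ (cfc (fun s => f s) H φ)).re = _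
  rw [cfc_apply_of_eigenvector hH hφ hφ0 (fun s => f s) f.continuous, inner_smul_right,
    inner_self_eq_norm_sq_to_K, ENNReal.toReal_ofReal (by positivity)]
  rw [RCLike.ofReal_eq_complex_ofReal, ← Complex.ofReal_pow, ← Complex.ofReal_mul,
    Complex.ofReal_re, mul_comm, smul_eq_mul]

/-- Eigenvectors with eigenvalue in `I` are in the range of `χ_I(H)`. -/
theorem spectralProjection_of_eigenvector {H : E →L[ℂ] E} (hH : IsSelfAdjoint H) {I : Set ℝ}
    {e : ℝ} (he : e ∈ I) {φ : E} (hφ : H φ = (e : ℂ) • φ) (hφ0 : φ ≠ 0) :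
    spectralProjection H I φ = φ := by
  refine Submodule.starProjection_eq_self_iff.mpr
    (Submodule.le_topologicalClosure _ (Submodule.subset_span ?_))
  rw [Set.mem_ofPred_eq, spectralMeasure_of_eigenvector hH hφ hφ0]
  simp [he]

theorem evolution_mem_unitary {H : E →L[ℂ] E} (hH : IsSelfAdjoint H) (t : ℝ) :
    evolution H t ∈ unitary (E →L[ℂ] E) := by
  let _ : NormedAlgebra ℚ (E →L[ℂ] E) := .restrictScalars ℚ ℂ _
  refine NormedSpace.exp_mem_unitary_of_mem_skewAdjoint
    (hH.smul_mem_skewAdjoint (r := -(Complex.I * t)) ?_)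
  simp [skewAdjoint.mem_iff]

theorem norm_evolution_apply {H : E →L[ℂ] E} (hH : IsSelfAdjoint H) (t : ℝ) (ψ : E) :
    ‖evolution H t ψ‖ = ‖ψ‖ := by
  have h := (Unitary.mem_iff.mp (evolution_mem_unitary hH t)).1
  exact (ContinuousLinearMap.norm_map_iff_adjoint_comp_self _).mpr h ψ

theorem evolution_add (H : E →L[ℂ] E) (s t : ℝ) :
    evolution H (s + t) = evolution H s * evolution H t := by
  let _ : NormedAlgebra ℚ (E →L[ℂ] E) := .restrictScalars ℚ ℂ _
  unfold evolution
  rw [← NormedSpace.exp_add_of_commute]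
  · congr 1
    rw [← add_smul]
    push_cast
    ring_nf
  · exact ((Commute.refl H).smul_left _).smul_right _

/-- If `A` is close to zero, then `e^A` has no other fixed vectors than those of `ker A`. -/
theorem exists_forall_exp_fixed_imp :
    ∃ δ > 0, ∀ A : E →L[ℂ] E, ‖A‖ < δ → ∀ v : E, NormedSpace.exp A v = v → A v = 0 := by
  let _ : NormedAlgebra ℚ (E →L[ℂ] E) := .restrictScalars ℚ ℂ _
  have hc : ContinuousAt (NormedSpace.exp : (E →L[ℂ] E) → (E →L[ℂ] E)) 0 :=
    NormedSpace.exp_continuous.continuousAt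
  rw [Metric.continuousAt_iff] at hc
  obtain ⟨δ, hδ, h⟩ := hc (1 / 2) (by norm_num)
  refine ⟨δ, hδ, fun A hA v hv => ?_⟩
  -- The derivative `(e^{tA} - 1) A v` has norm at most `‖A v‖ / 2`, while `f 1 - f 0 = -A v` for a
  -- fixed vector; hence `‖A v‖ ≤ ‖A v‖ / 2`.
  let f : ℝ → E := fun t => NormedSpace.exp (t • A) v - t • A v
  have hf : ∀ t ∈ Set.Icc (0 : ℝ) 1,
      HasDerivWithinAt f ((NormedSpace.exp (t • A) - 1) (A v)) (Set.Icc 0 1) t := by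
    intro t _
    have h1 : HasDerivAt (fun t : ℝ => NormedSpace.exp (t • A)) (NormedSpace.exp (t • A) * A) t :=
      hasDerivAt_exp_smul_const A t
    have h2 := ((ContinuousLinearMap.apply ℂ E v).restrictScalars ℝ).hasFDerivAt.comp_hasDerivAt t h1
    have h3 : HasDerivAt (fun t : ℝ => t • A v) (A v) t := by
      simpa using (hasDerivAt_id t).smul_const (A v)
    have h4 := h2.sub h3
    exact h4.hasDerivWithinAt
  have hb : ∀ t ∈ Set.Ico (0 : ℝ) 1, ‖(NormedSpace.exp (t • A) - 1) (A v)‖ ≤ 1 / 2 * ‖A v‖ := by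
    intro t ht
    refine (ContinuousLinearMap.le_opNorm _ _).trans ?_
    gcongr
    have h5 : dist (t • A) 0 < δ := by
      rw [dist_zero_right, norm_smul, Real.norm_of_nonneg ht.1]
      nlinarith [norm_nonneg A, ht.2]
    have h6 := h h5
    rw [NormedSpace.exp_zero, dist_eq_norm] at h6
    exact h6.le
  have hmv := norm_image_sub_le_of_norm_deriv_le_segment_01' hf hb
  have h7 : f 1 - f 0 = - A v := by
    simp [f, hv]
  rw [h7, norm_neg] at hmv
  rw [← norm_eq_zero]
  linarith [norm_nonneg (A v)]

/-- For a simple eigenvalue `e ∈ I` with unit eigenvector `φ`, the matrix elements of the projection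
onto `φ` are dominated by those of the evolution. -/
theorem norm_inner_mul_norm_inner_le {H : E →L[ℂ] E} (hH : IsSelfAdjoint H) {I : Set ℝ}
    {e : ℝ} (he : e ∈ I) {φ : E} (hφ : H φ = (e : ℂ) • φ) (hφ1 : ‖φ‖ = 1)
    (hsimple : ∀ ψ : E, H ψ = (e : ℂ) • ψ → ∃ k : ℂ, ψ = k • φ) (u v : E) {S : ℝ}
    (hS : ∀ t : ℝ, ‖inner ℂ v (evolution H t (spectralProjection H I u))‖ ≤ S) :
    ‖inner ℂ φ u‖ * ‖inner ℂ v φ‖ ≤ S := by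
  let _ : NormedAlgebra ℚ (E →L[ℂ] E) := .restrictScalars ℚ ℂ _
  have hφ0 : φ ≠ 0 := by rintro rfl; simp at hφ1
  obtain ⟨δ, hδ, hfix⟩ := exists_forall_exp_fixed_imp (E := E)
  set B : E →L[ℂ] E := H - (e : ℂ) • 1 with hB
  have hBsa : IsSelfAdjoint B := by
    refine hH.sub (IsSelfAdjoint.smul ?_ (IsSelfAdjoint.one _))
    simp [IsSelfAdjoint]
  -- A small time step prevents aliasing: `e^{-isB}` then fixes only `ker B`, not spectral parts of
  -- `B` at nonzero multiples of `2π/s`.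
  obtain ⟨s, hs, hsδ⟩ : ∃ s : ℝ, 0 < s ∧ s * ‖B‖ < δ := by
    refine ⟨δ / (‖B‖ + 1), by positivity, ?_⟩
    rw [div_mul_eq_mul_div, div_lt_iff₀ (by positivity)]
    nlinarith [norm_nonneg B]
  set U : E →L[ℂ] E := evolution B s with hU
  have hUn : ‖U‖ ≤ 1 := ContinuousLinearMap.opNorm_le_bound _ zero_le_one fun ψ => by
    rw [hU, norm_evolution_apply hBsa, one_mul]
  have hUpow : ∀ k : ℕ, U ^ k = evolution B (k * s) := by
    intro k
    induction k with
    | zero => simp [evolution]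
    | succ k ih => rw [pow_succ, ih, hU, ← evolution_add]; congr 1; push_cast; ring
  have hBH : ∀ t : ℝ, evolution B t = Complex.exp (Complex.I * t * e) • evolution H t := by
    intro t
    have h1 : (-(Complex.I * t)) • B
        = (-(Complex.I * t)) • H + algebraMap ℂ (E →L[ℂ] E) (Complex.I * t * e) := by
      rw [hB, Algebra.algebraMap_eq_smul_one, smul_sub, smul_smul, sub_eq_add_neg, ← neg_smul]
      congr 2
      ring
    unfold evolution
    rw [h1, NormedSpace.exp_add_of_commute (Algebra.commutes _ _).symm,
      ← NormedSpace.algebraMap_exp_comm, ← Complex.exp_eq_exp_ℂ, Algebra.algebraMap_eq_smul_one,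
      mul_smul_comm, mul_one]
  have hker : (U.eqLocus (1 : E →L[ℂ] E)) = Submodule.span ℂ {φ} := by
    ext ψ
    rw [Submodule.mem_span_singleton]
    constructor
    · intro h
      have h1 : (-(Complex.I * s)) • B ψ = 0 := by
        refine hfix ((-(Complex.I * s)) • B) ?_ ψ h
        rw [norm_smul]
        simpa [abs_of_pos hs] using hsδ
      have h2 : B ψ = 0 := by
        rcases smul_eq_zero.mp h1 with h | h
        · simp [hs.ne'] at h
        · exact h
      obtain ⟨k, hk⟩ := hsimple ψ (by simpa [hB, sub_eq_zero] using h2)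
      exact ⟨k, hk.symm⟩
    · rintro ⟨k, rfl⟩
      change U (k • φ) = k • φ
      have h1 : ∀ t : ℝ, HasDerivAt (fun t : ℝ => evolution B t φ) 0 t := by
        intro t
        have h2 : HasDerivAt (fun t : ℝ => NormedSpace.exp (t • (-Complex.I • B)))
            (NormedSpace.exp (t • (-Complex.I • B)) * (-Complex.I • B)) t :=
          hasDerivAt_exp_smul_const _ t
        have h3 := ((ContinuousLinearMap.apply ℂ E φ).restrictScalars ℝ).hasFDerivAt.comp_hasDerivAt
          t h2
        convert h3 using 1
        · funext r
          simp only [evolution, Function.comp]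
          congr 2
          ext ψ
          simp [smul_smul, ← Complex.coe_smul, mul_comm]
        · simp [hB, hφ]
      have h4 := is_const_of_deriv_eq_zero (fun t => (h1 t).differentiableAt)
        (fun t => (h1 t).deriv) s 0
      rw [map_smul, hU, h4]
      simp [evolution]
  set P := spectralProjection H I with hP
  -- Von Neumann's mean ergodic theorem: the averages of `U ^ k` converge to the projection onto the
  -- fixed space, here the line of `φ`.
  have hlim := U.tendsto_birkhoffAverage_orthogonalProjection hUn (P u)
  have hproj : (((U.eqLocus (1 : E →L[ℂ] E)).orthogonalProjectionOnto (P u) :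
      U.eqLocus (1 : E →L[ℂ] E)) : E) = (inner ℂ φ u : ℂ) • φ := by
    rw [← Submodule.starProjection_apply]
    have h1 : (U.eqLocus (1 : E →L[ℂ] E)).starProjection (P u)
        = (Submodule.span ℂ {φ}).starProjection (P u) := by
      congr 2
    rw [h1, Submodule.starProjection_unit_singleton ℂ hφ1]
    congr 1
    -- By self-adjointness `χ_I(H)` moves onto `φ`, which it fixes.
    rw [hP, spectralProjection, ← Submodule.inner_starProjection_left_eq_right,
      ← spectralProjection, spectralProjection_of_eigenvector hH he hφ hφ0]
  rw [hproj] at hlim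
  have hlim2 := ((continuous_const (y := v)).inner continuous_id (𝕜 := ℂ)).norm.tendsto
    ((inner ℂ φ u : ℂ) • φ) |>.comp hlim
  have heq : ‖inner ℂ v ((inner ℂ φ u : ℂ) • φ)‖ = ‖inner ℂ φ u‖ * ‖inner ℂ v φ‖ := by
    rw [inner_smul_right, norm_mul]
  simp only [id] at hlim2
  rw [heq] at hlim2
  have hS0 : 0 ≤ S := (norm_nonneg _).trans (hS 0)
  refine le_of_tendsto hlim2 (.of_forall fun N => ?_)
  simp only [Function.comp, birkhoffAverage, birkhoffSum, id]
  rw [inner_smul_right, norm_mul, inner_sum]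
  have h8 : ‖∑ k ∈ Finset.range N, inner ℂ v (U^[k] (P u))‖ ≤ N * S := by
    refine (norm_sum_le _ _).trans ?_
    refine (Finset.sum_le_sum (g := fun _ => S) fun k _ => ?_).trans (by simp)
    -- `U ^ k` is the evolution of `H` at time `k * s` up to a phase, so the bound `S` applies to
    -- each term.
    rw [← FunLike.coe_pow_eq_iterate, hUpow, hBH, smul_apply, inner_smul_right, norm_mul]
    have : ‖Complex.exp (Complex.I * ((k * s : ℝ) : ℂ) * e)‖ = 1 := by
      rw [mul_assoc, ← Complex.ofReal_mul, mul_comm, Complex.norm_exp_ofReal_mul_I]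
    rw [this, one_mul]
    exact hS _
  rcases Nat.eq_zero_or_pos N with rfl | hN
  · simpa using hS0
  · have hN' : (0 : ℝ) < N := by exact_mod_cast hN
    calc _ ≤ ‖((N : ℂ))⁻¹‖ * (N * S) := by gcongr
      _ = S := by rw [norm_inv, Complex.norm_natCast]; field_simp

end SpectralTheory

end Anderson

namespace Anderson

/-! ### Almost sure simplicity of the eigenvalues. -/

section Simplicity

variable {Γ : Type*} (G : SimpleGraph Γ) [G.LocallyFinite] (K : ℕ) (hK : ∀ x, G.degree x ≤ K)

theorem hamiltonian_apply (lam : ℝ) {a b : ℝ} (ω : Γ → Set.Icc a b) (ψ : ell2 Γ) (x : Γ) :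
    hamiltonian G K hK lam ω ψ x
      = -∑ y ∈ G.neighborFinset x, (ψ y - ψ x) + lam * ((ω x : ℝ) * ψ x) := by
  rw [← negLaplacian_apply G K hK]
  rfl

/-- Changing the potential at `x` is a rank one perturbation. -/
theorem hamiltonian_update [DecidableEq Γ] (lam : ℝ) {a b : ℝ} (ω : Γ → Set.Icc a b) (x : Γ)
    (v : Set.Icc a b) (ψ : ell2 Γ) :
    hamiltonian G K hK lam (Function.update ω x v) ψ
      = hamiltonian G K hK lam ω ψ + ((lam * ((v : ℝ) - ω x) : ℝ) * ψ x) • delta x := by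
  ext y
  rw [lp.coeFn_add, Pi.add_apply, lp.coeFn_smul, Pi.smul_apply, hamiltonian_apply,
    hamiltonian_apply, delta_apply]
  by_cases h : y = x
  · subst h
    simp
    ring
  · simp [h]

/-- A self-adjoint operator on `ℓ²(Γ)`, `Γ` countable, has countably many eigenvalues. -/
theorem countable_eigenvalues [Countable Γ] {H : ell2 Γ →L[ℂ] ell2 Γ} (hH : IsSelfAdjoint H) :
    {e : ℝ | ∃ φ : ell2 Γ, φ ≠ 0 ∧ H φ = (e : ℂ) • φ}.Countable := by
  set T := {e : ℝ | ∃ φ : ell2 Γ, φ ≠ 0 ∧ H φ = (e : ℂ) • φ} with hT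
  have hex : ∀ e : T, ∃ φ : ell2 Γ, ‖φ‖ = 1 ∧ H φ = ((e : ℝ) : ℂ) • φ := by
    rintro ⟨e, φ, hφ0, hφ⟩
    refine ⟨((‖φ‖⁻¹ : ℝ) : ℂ) • φ, ?_, ?_⟩
    · rw [norm_smul, Complex.norm_real, norm_inv, norm_norm,
        inv_mul_cancel₀ (norm_ne_zero_iff.mpr hφ0)]
    · exact (map_smul H _ φ).trans ((congrArg _ hφ).trans (smul_comm _ _ _))
  choose f hf1 hf using hex
  have hsymm := ContinuousLinearMap.isSelfAdjoint_iff_isSymmetric.mp hH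
  have hon : Orthonormal ℂ f := by
    refine ⟨hf1, fun e e' hee => ?_⟩
    have h := hsymm (f e) (f e')
    simp only [ContinuousLinearMap.coe_coe, hf, inner_smul_left, inner_smul_right,
      Complex.conj_ofReal] at h
    have h2 : (((e : ℝ) : ℂ) - (e' : ℝ)) * inner ℂ (f e) (f e') = 0 := by
      rw [sub_mul, h, sub_self]
    rcases mul_eq_zero.mp h2 with h3 | h3
    · exact absurd (Subtype.ext (Complex.ofReal_injective (sub_eq_zero.mp h3))) hee
    · exact h3
  -- By Bessel, each `delta z` meets only countably many of the orthonormal eigenvectors, and each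
  -- eigenvector is nonzero at some `z`.
  have hz : ∀ z : Γ, {e : T | f e z ≠ 0}.Countable := by
    intro z
    have h := (hon.inner_products_summable (delta z)).countable_support
    refine h.mono fun e he => ?_
    rw [Function.mem_support]
    have : inner ℂ (f e) (delta z) = (starRingEnd ℂ) (f e z) := by
      rw [← inner_conj_symm, inner_delta_left]
    rw [this]
    simpa using he
  have huniv : (Set.univ : Set T) = ⋃ z : Γ, {e : T | f e z ≠ 0} := by
    ext e
    simp only [Set.mem_univ, Set.mem_iUnion, true_iff]
    by_contra! hcon
    have h0 : f e = 0 := by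
      ext z
      by_contra h
      exact hcon z h
    have := hf1 e
    simp [h0] at this
  have : (Set.univ : Set T).Countable := by
    rw [huniv]
    exact Set.countable_iUnion hz
  exact Set.countable_coe_iff.mp (Set.countable_univ_iff.mp this)

/-- The configurations for which some eigenvalue has an eigenvector vanishing at `x` and another one
not vanishing at `x`. -/
def degenerateAt (lam a b : ℝ) (x : Γ) : Set (Γ → Set.Icc a b) :=
  {ω | ∃ (e : ℝ) (φ ψ : ell2 Γ), hamiltonian G K hK lam ω φ = (e : ℂ) • φ ∧
    hamiltonian G K hK lam ω ψ = (e : ℂ) • ψ ∧ φ ≠ 0 ∧ φ x = 0 ∧ ψ x ≠ 0}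

/-- An eigenvector vanishing at `x` does not feel the potential there, so `e` belongs to the
countable set of eigenvalues for the original `ω`, whatever `v` is. For fixed `e`, at most one `v`
admits an eigenvector `ψ` nonzero at `x`: symmetry applied to two such eigenvectors gives `lam * (v
- v') * conj (ψ' x) * ψ x = 0`. -/
theorem countable_setOf_update_mem_degenerateAt [Countable Γ] [DecidableEq Γ] {lam : ℝ}
    (hlam : lam ≠ 0) {a b : ℝ} (x : Γ) (ω : Γ → Set.Icc a b) :
    {v | Function.update ω x v ∈ degenerateAt G K hK lam a b x}.Countable := by
  set T := {e : ℝ | ∃ φ : ell2 Γ, φ ≠ 0 ∧ hamiltonian G K hK lam ω φ = (e : ℂ) • φ}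
  have hT : T.Countable := countable_eigenvalues (hamiltonian_isSelfAdjoint G K hK lam ω)
  have hsub : ∀ e : ℝ, {v : Set.Icc a b | ∃ ψ : ell2 Γ, ψ x ≠ 0 ∧
      hamiltonian G K hK lam (Function.update ω x v) ψ = (e : ℂ) • ψ}.Subsingleton := by
    rintro e v ⟨ψ, hψ0, hψ⟩ v' ⟨ψ', hψ0', hψ'⟩
    have hsymm := ContinuousLinearMap.isSelfAdjoint_iff_isSymmetric.mp
      (hamiltonian_isSelfAdjoint G K hK lam (Function.update ω x v)) ψ' ψ
    have h1 : hamiltonian G K hK lam (Function.update ω x v) ψ'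
        = (e : ℂ) • ψ' + ((lam * ((v : ℝ) - v') : ℝ) * ψ' x) • delta x := by
      rw [← hψ', hamiltonian_update, hamiltonian_update, add_assoc, ← add_smul]
      congr 2
      push_cast
      ring
    simp only [ContinuousLinearMap.coe_coe] at hsymm
    rw [h1, hψ, inner_add_left, inner_smul_left, inner_smul_right, Complex.conj_ofReal,
      add_eq_left, inner_smul_left, inner_delta_left] at hsymm
    simp only [map_mul, Complex.conj_ofReal, mul_eq_zero, hψ0, or_false, map_eq_zero, hψ0',
      Complex.ofReal_eq_zero, hlam, false_or] at hsymm
    exact Subtype.ext (sub_eq_zero.mp hsymm)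
  refine (hT.biUnion fun e _ => (hsub e).countable).mono ?_
  rintro v ⟨e, φ, ψ, hφ, hψ, hφ0, hφx, hψx⟩
  refine Set.mem_biUnion (x := e) ⟨φ, hφ0, ?_⟩ ⟨ψ, hψx, hψ⟩
  rw [← hφ, hamiltonian_update, hφx]
  simp

/-! ### Measurability of the degenerate configurations, by compactness. -/

/-- Square-summable functions of norm at most one, as a set of functions on `Γ`. -/
def unitBallFun (Γ : Type*) : Set (Γ → ℂ) := {f | ∀ s : Finset Γ, ∑ x ∈ s, ‖f x‖ ^ 2 ≤ 1}

theorem isCompact_unitBallFun : IsCompact (unitBallFun Γ) := by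
  have hcl : IsClosed (unitBallFun Γ) := by
    have : unitBallFun Γ = ⋂ s : Finset Γ, {f | ∑ x ∈ s, ‖f x‖ ^ 2 ≤ 1} := by
      ext f; simp [unitBallFun]
    rw [this]
    refine isClosed_iInter fun s => isClosed_le (by fun_prop) continuous_const
  refine (isCompact_univ_pi fun _ : Γ => isCompact_closedBall (0 : ℂ) 1).of_isClosed_subset hcl ?_
  intro f hf x _
  have h := hf {x}
  rw [Finset.sum_singleton] at h
  rw [mem_closedBall_zero_iff]
  exact (sq_le_one_iff₀ (norm_nonneg _)).mp h

theorem coe_mem_unitBallFun {φ : ell2 Γ} (hφ : ‖φ‖ ≤ 1) : (φ : Γ → ℂ) ∈ unitBallFun Γ := by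
  intro s
  have h := lp.sum_rpow_le_norm_rpow (p := 2) (by simp) φ s
  simp only [ENNReal.toReal_ofNat, Real.rpow_ofNat] at h
  exact h.trans (pow_le_one₀ (norm_nonneg _) hφ)

theorem exists_ell2_of_mem_unitBallFun {f : Γ → ℂ} (hf : f ∈ unitBallFun Γ) :
    ∃ φ : ell2 Γ, (φ : Γ → ℂ) = f :=
  ⟨⟨f, memℓp_gen' (C := 1) fun s => by simpa using hf s⟩, rfl⟩

/-- The eigenvalue equation for functions on `Γ` which need not be square-summable. -/
def eigenEquation (lam : ℝ) {a b : ℝ} (ω : Γ → Set.Icc a b) (e : ℝ) (f : Γ → ℂ) : Prop :=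
  ∀ x, -∑ y ∈ G.neighborFinset x, (f y - f x) + lam * ((ω x : ℝ) * f x) = e * f x

theorem hamiltonian_eq_smul_iff {lam : ℝ} {a b : ℝ} {ω : Γ → Set.Icc a b} {e : ℝ} {φ : ell2 Γ} :
    hamiltonian G K hK lam ω φ = (e : ℂ) • φ ↔ eigenEquation G lam ω e φ := by
  constructor
  · intro h x
    rw [← hamiltonian_apply G K hK, h]
    rfl
  · intro h
    ext x
    rw [hamiltonian_apply]
    exact h x

theorem isClosed_eigenEquation (lam a b : ℝ) :
    IsClosed {p : (Γ → Set.Icc a b) × ℝ × (Γ → ℂ) | eigenEquation G lam p.1 p.2.1 p.2.2} := by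
  have : {p : (Γ → Set.Icc a b) × ℝ × (Γ → ℂ) | eigenEquation G lam p.1 p.2.1 p.2.2}
      = ⋂ x, {p | -∑ y ∈ G.neighborFinset x, (p.2.2 y - p.2.2 x)
          + lam * (((p.1 x : ℝ) : ℂ) * p.2.2 x) = p.2.1 * p.2.2 x} := by
    ext p; simp [eigenEquation]
  rw [this]
  refine isClosed_iInter fun x => isClosed_eq ?_ ?_ <;> fun_prop

/-- Projections of measurable sets need not be measurable, but projections of compact sets are
compact. The index `n` bounds the energy and turns the two nonvanishing conditions into closed ones.
The eigenvalue equation is closed for pointwise convergence because each vertex has finitely many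
neighbors. -/
theorem measurableSet_degenerateAt [Countable Γ] (lam a b : ℝ) (x : Γ) :
    MeasurableSet (degenerateAt G K hK lam a b x) := by
  let C : ℕ → Γ → Set ((Γ → Set.Icc a b) × ℝ × (Γ → ℂ) × (Γ → ℂ)) := fun n z =>
    (Set.univ ×ˢ Set.Icc (-n : ℝ) n ×ˢ unitBallFun Γ ×ˢ unitBallFun Γ) ∩
      {p | eigenEquation G lam p.1 p.2.1 p.2.2.1 ∧ eigenEquation G lam p.1 p.2.1 p.2.2.2 ∧
        1 ≤ n * ‖p.2.2.1 z‖ ∧ p.2.2.1 x = 0 ∧ 1 ≤ n * ‖p.2.2.2 x‖}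
  have hC : ∀ n z, IsCompact (C n z) := by
    intro n z
    refine (isCompact_univ.prod (isCompact_Icc.prod
      (isCompact_unitBallFun.prod isCompact_unitBallFun))).inter_right ?_
    have h1 := (isClosed_eigenEquation G lam a b).preimage
      (f := fun p : (Γ → Set.Icc a b) × ℝ × (Γ → ℂ) × (Γ → ℂ) => (p.1, p.2.1, p.2.2.1))
      (by fun_prop)
    have h2 := (isClosed_eigenEquation G lam a b).preimage
      (f := fun p : (Γ → Set.Icc a b) × ℝ × (Γ → ℂ) × (Γ → ℂ) => (p.1, p.2.1, p.2.2.2))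
      (by fun_prop)
    have h3 : Continuous fun p : (Γ → Set.Icc a b) × ℝ × (Γ → ℂ) × (Γ → ℂ) =>
        (n : ℝ) * ‖p.2.2.1 z‖ := by fun_prop
    have h4 : Continuous fun p : (Γ → Set.Icc a b) × ℝ × (Γ → ℂ) × (Γ → ℂ) => p.2.2.1 x := by
      fun_prop
    have h5 : Continuous fun p : (Γ → Set.Icc a b) × ℝ × (Γ → ℂ) × (Γ → ℂ) =>
        (n : ℝ) * ‖p.2.2.2 x‖ := by fun_prop
    exact h1.inter (h2.inter ((isClosed_le continuous_const h3).inter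
      ((isClosed_eq h4 continuous_const).inter (isClosed_le continuous_const h5))))
  have heq : degenerateAt G K hK lam a b x = ⋃ n : ℕ, ⋃ z : Γ, Prod.fst '' C n z := by
    ext ω
    simp only [Set.mem_iUnion, Set.mem_image]
    constructor
    · rintro ⟨e, φ, ψ, hφ, hψ, hφ0, hφx, hψx⟩
      have hψ0 : ψ ≠ 0 := by rintro rfl; simp at hψx
      obtain ⟨z, hz⟩ : ∃ z, φ z ≠ 0 := by
        by_contra! h
        exact hφ0 (by ext z; exact h z)
      have scale : ∀ χ : ell2 Γ, χ ≠ 0 → hamiltonian G K hK lam ω χ = (e : ℂ) • χ →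
          ∃ r : ℂ, r ≠ 0 ∧ ‖r • χ‖ ≤ 1 ∧ hamiltonian G K hK lam ω (r • χ) = (e : ℂ) • (r • χ) := by
        intro χ h0 h
        refine ⟨((‖χ‖⁻¹ : ℝ) : ℂ), ?_, ?_, ?_⟩
        · simpa using h0
        · rw [norm_smul, Complex.norm_real, norm_inv, norm_norm,
            inv_mul_cancel₀ (norm_ne_zero_iff.mpr h0)]
        · rw [map_smul, h, smul_comm]
      obtain ⟨r, hr0, hr1, hr⟩ := scale φ hφ0 hφ
      obtain ⟨q, hq0, hq1, hq⟩ := scale ψ hψ0 hψ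
      have hrz : 0 < ‖(r • φ) z‖ := by
        rw [lp.coeFn_smul, Pi.smul_apply]
        exact norm_pos_iff.mpr (smul_ne_zero hr0 hz)
      have hqx : 0 < ‖(q • ψ) x‖ := by
        rw [lp.coeFn_smul, Pi.smul_apply]
        exact norm_pos_iff.mpr (smul_ne_zero hq0 hψx)
      obtain ⟨n, hn⟩ := exists_nat_ge (max |e| (max ‖(r • φ) z‖⁻¹ ‖(q • ψ) x‖⁻¹))
      simp only [max_le_iff] at hn
      refine ⟨n, z, (ω, e, (r • φ : ell2 Γ), (q • ψ : ell2 Γ)), ⟨⟨Set.mem_univ _,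
        abs_le.mp hn.1, coe_mem_unitBallFun hr1, coe_mem_unitBallFun hq1⟩,
        (hamiltonian_eq_smul_iff G K hK).mp hr, (hamiltonian_eq_smul_iff G K hK).mp hq, ?_, ?_, ?_⟩,
        rfl⟩
      · exact (inv_le_iff_one_le_mul₀ hrz).mp hn.2.1
      · simp [hφx]
      · exact (inv_le_iff_one_le_mul₀ hqx).mp hn.2.2
    · rintro ⟨n, z, ⟨ω', e, f, g⟩, ⟨⟨-, -, hf, hg⟩, hf', hg', hfz, hfx, hgx⟩, rfl⟩
      obtain ⟨φ, rfl⟩ := exists_ell2_of_mem_unitBallFun hf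
      obtain ⟨ψ, rfl⟩ := exists_ell2_of_mem_unitBallFun hg
      refine ⟨e, φ, ψ, (hamiltonian_eq_smul_iff G K hK).mpr hf',
        (hamiltonian_eq_smul_iff G K hK).mpr hg', ?_, hfx, ?_⟩
      · rintro rfl
        norm_num at hfz
      · intro h
        simp only [h] at hgx
        norm_num at hgx
  rw [heq]
  exact .iUnion fun n => .iUnion fun z => ((hC n z).image continuous_fst).measurableSet

/-! ### Resampling one site, and simplicity by Fubini. -/

theorem measurable_update_prod {ι X : Type*} [DecidableEq ι] [MeasurableSpace X] (i : ι) :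
    Measurable fun p : (ι → X) × X => Function.update p.1 i p.2 := by
  rw [measurable_pi_iff]
  intro j
  by_cases h : j = i
  · subst h; simpa using measurable_snd
  · simpa [h, Function.comp_def] using (measurable_pi_apply j).comp measurable_fst

/-- Resampling one coordinate preserves a product measure. -/
theorem map_update_infinitePi {ι X : Type*} [DecidableEq ι] [MeasurableSpace X] (μ : Measure X)
    [IsProbabilityMeasure μ] (i : ι) :
    ((Measure.infinitePi fun _ : ι => μ).prod μ).map (fun p => Function.update p.1 i p.2)
      = Measure.infinitePi fun _ : ι => μ := by
  refine Measure.eq_infinitePi _ fun s t ht => ?_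
  have hm := measurable_update_prod (X := X) i
  rw [Measure.map_apply hm (.pi s.countable_toSet fun _ _ => ht _)]
  by_cases hi : i ∈ s
  · have : (fun p : (ι → X) × X => Function.update p.1 i p.2) ⁻¹' (Set.pi s t)
        = (Set.pi (s.erase i) t) ×ˢ t i := by
      ext ⟨f, v⟩
      simp only [Set.mem_preimage, Set.mem_pi, Set.mem_prod, Finset.mem_coe, Finset.mem_erase]
      constructor
      · intro h
        refine ⟨fun j hj => ?_, by simpa using h i hi⟩
        simpa [hj.1] using h j hj.2
      · rintro ⟨h1, h2⟩ j hj
        by_cases hji : j = i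
        · subst hji; simpa using h2
        · simpa [hji] using h1 j ⟨hji, hj⟩
    rw [this, Measure.prod_prod, Measure.infinitePi_pi _ fun _ _ => ht _,
      Finset.prod_erase_mul _ _ hi]
  · have : (fun p : (ι → X) × X => Function.update p.1 i p.2) ⁻¹' (Set.pi s t)
        = (Set.pi s t) ×ˢ Set.univ := by
      ext ⟨f, v⟩
      simp only [Set.mem_preimage, Set.mem_pi, Set.mem_prod, Finset.mem_coe, Set.mem_univ, and_true]
      refine forall₂_congr fun j hj => ?_
      have : j ≠ i := fun h => hi (h ▸ hj)
      simp [this]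
    rw [this, Measure.prod_prod, Measure.infinitePi_pi _ fun _ _ => ht _, measure_univ, mul_one]

/-- After resampling the site `x`, Fubini leaves for each `ω` a countable set of values `v`, which
is null for a measure without atoms. -/
theorem measure_degenerateAt [Countable Γ] {lam : ℝ} (hlam : lam ≠ 0) {a b : ℝ}
    (μ : Measure (Set.Icc a b)) [IsProbabilityMeasure μ] (hμ : ∀ v, μ {v} = 0) (x : Γ) :
    (Measure.infinitePi fun _ : Γ => μ) (degenerateAt G K hK lam a b x) = 0 := by
  classical
  have hmeas := measurableSet_degenerateAt G K hK lam a b x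
  have hm := measurable_update_prod (X := Set.Icc a b) x
  rw [← map_update_infinitePi μ x, Measure.map_apply hm hmeas, Measure.measure_prod_null (hm hmeas)]
  have : NullSingletonClass μ := ⟨hμ⟩
  exact .of_forall fun ω =>
    (countable_setOf_update_mem_degenerateAt G K hK hlam x ω).measure_zero μ

/-- Almost surely, all eigenvalues of the Anderson Hamiltonian are simple. -/
theorem ae_simple_eigenvalues [Countable Γ] {lam : ℝ} (hlam : lam ≠ 0) {a b : ℝ}
    (μ : Measure (Set.Icc a b)) [IsProbabilityMeasure μ] (hμ : ∀ v, μ {v} = 0) :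
    ∀ᵐ ω ∂(Measure.infinitePi fun _ : Γ => μ), ∀ (e : ℝ) (φ ψ : ell2 Γ), φ ≠ 0 →
      hamiltonian G K hK lam ω φ = (e : ℂ) • φ → hamiltonian G K hK lam ω ψ = (e : ℂ) • ψ →
      ∃ k : ℂ, ψ = k • φ := by
  have h : ∀ᵐ ω ∂(Measure.infinitePi fun _ : Γ => μ), ∀ x, ω ∉ degenerateAt G K hK lam a b x :=
    ae_all_iff.mpr fun x => measure_eq_zero_iff_ae_notMem.mp
      (measure_degenerateAt G K hK hlam μ hμ x)
  filter_upwards [h] with ω hω e φ ψ hφ0 hφ hψ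
  obtain ⟨x, hx⟩ : ∃ x, φ x ≠ 0 := by
    by_contra! h
    exact hφ0 (by ext z; exact h z)
  refine ⟨ψ x / φ x, ?_⟩
  by_contra hne
  -- This combination is an eigenvector vanishing at `x`, whereas `φ` does not vanish there.
  refine hω x ⟨e, ψ - (ψ x / φ x) • φ, φ, ?_, hφ, sub_ne_zero.mpr hne, ?_, hx⟩
  · rw [map_sub, map_smul, hφ, hψ, smul_sub, smul_comm]
  · rw [lp.coeFn_sub, Pi.sub_apply, lp.coeFn_smul, Pi.smul_apply, smul_eq_mul,
      div_mul_cancel₀ _ hx, sub_self]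

end Simplicity

end Anderson

namespace Anderson

/-! ### Summable amplitudes and decay from a center. -/

section Decay

variable {Γ : Type*}

theorem SubexponentialGrowth.countable [MetricSpace Γ] {ζ : ℝ} (h : SubexponentialGrowth Γ ζ) :
    Countable Γ := by
  rcases isEmpty_or_nonempty Γ with hΓ | ⟨⟨x⟩⟩
  · infer_instance
  · obtain ⟨A, hA⟩ := h x 1 one_pos
    rw [← Set.countable_univ_iff, ← Metric.iUnion_closedBall_nat x]
    exact Set.countable_iUnion fun n => (hA n n.cast_nonneg).1.countable

/-- Subexponential growth makes `e^{-ε dist(x,·)^ζ}` summable. -/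
theorem SubexponentialGrowth.tsum_exp_ne_top [MetricSpace Γ] {ζ : ℝ} (hζ : 0 < ζ)
    (h : SubexponentialGrowth Γ ζ) (x : Γ) {ε : ℝ} (hε : 0 < ε) :
    ∑' y, ENNReal.ofReal (Real.exp (-ε * dist x y ^ ζ)) ≠ ∞ := by
  obtain ⟨A, hA⟩ := h x (ε / 2) (by positivity)
  have hA0 : 0 ≤ A := by
    have h1 := (hA 0 le_rfl).2
    by_contra! hneg
    have : A * Real.exp (ε / 2 * 0 ^ ζ) < 0 := mul_neg_of_neg_of_pos hneg (Real.exp_pos _)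
    linarith [(Nat.cast_nonneg _ : (0 : ℝ) ≤ ((Metric.closedBall x 0).ncard : ℝ))]
  -- With radii `n^{1/ζ}` the growth bound is `A e^{εn/2}`, so the weights `e^{-εn}` leave a
  -- geometric series. The factor `e^ε` below pays for rounding `dist x y ^ ζ` up to an integer.
  let B : ℕ → Set Γ := fun n => Metric.closedBall x ((n : ℝ) ^ ζ⁻¹)
  have hball : ∀ n : ℕ, (B n).Finite ∧ ((B n).ncard : ℝ) ≤ A * Real.exp (ε / 2 * n) := by
    intro n
    have h1 := hA ((n : ℝ) ^ ζ⁻¹) (by positivity)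
    rwa [Real.rpow_inv_rpow n.cast_nonneg hζ.ne'] at h1
  have hpt : ∀ y, ENNReal.ofReal (Real.exp (-ε * dist x y ^ ζ)) ≤
      ∑' n : ℕ, ENNReal.ofReal (Real.exp ε * Real.exp (-ε * n)) * (B n).indicator 1 y := by
    intro y
    set n := ⌈dist x y ^ ζ⌉₊ with hn
    have hd : 0 ≤ dist x y ^ ζ := by positivity
    have hy : y ∈ B n := by
      rw [Metric.mem_closedBall, dist_comm]
      calc dist x y = (dist x y ^ ζ) ^ ζ⁻¹ := (Real.rpow_rpow_inv dist_nonneg hζ.ne').symm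
        _ ≤ (n : ℝ) ^ ζ⁻¹ := Real.rpow_le_rpow hd (Nat.le_ceil _) (by positivity)
    refine le_trans ?_ (ENNReal.le_tsum n)
    rw [Set.indicator_of_mem hy, Pi.one_apply, mul_one, ← Real.exp_add]
    refine ENNReal.ofReal_le_ofReal (Real.exp_le_exp.mpr ?_)
    nlinarith [(Nat.ceil_lt_add_one hd).le]
  refine ne_top_of_le_ne_top ?_ (ENNReal.tsum_le_tsum hpt)
  rw [ENNReal.tsum_comm]
  have hsum : Summable fun n : ℕ => Real.exp ε * A * Real.exp (-(ε / 2)) ^ n :=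
    (summable_geometric_of_lt_one (Real.exp_pos _).le
      (by rw [← Real.exp_zero]; exact Real.exp_lt_exp.mpr (by linarith))).mul_left _
  refine ne_top_of_le_ne_top hsum.tsum_ofReal_ne_top (ENNReal.tsum_le_tsum fun n => ?_)
  rw [ENNReal.tsum_mul_left]
  have hcard : ∑' y, (B n).indicator (1 : Γ → ℝ≥0∞) y
      = ENNReal.ofReal ((B n).ncard : ℝ) := by
    rw [← tsum_subtype]
    simp only [Pi.one_apply]
    rw [ENNReal.tsum_set_one, ← (hball n).1.cast_ncard_eq]
    simp
  rw [hcard, ← ENNReal.ofReal_mul (by positivity)]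
  refine ENNReal.ofReal_le_ofReal ?_
  calc Real.exp ε * Real.exp (-ε * n) * ((B n).ncard : ℝ)
      ≤ Real.exp ε * Real.exp (-ε * n) * (A * Real.exp (ε / 2 * n)) := by
        gcongr; exact (hball n).2
    _ = Real.exp ε * A * (Real.exp (-ε * n) * Real.exp (ε / 2 * n)) := by ring
    _ = Real.exp ε * A * Real.exp (-(ε / 2)) ^ n := by
        rw [← Real.exp_add, ← Real.exp_nat_mul]
        congr 2
        ring

theorem supAmplitude_nonneg (H : ell2 Γ →L[ℂ] ell2 Γ) (I : Set ℝ) (x y : Γ) :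
    0 ≤ supAmplitude H I x y :=
  Real.iSup_nonneg fun _ => norm_nonneg _

theorem le_supAmplitude {H : ell2 Γ →L[ℂ] ell2 Γ} (hH : IsSelfAdjoint H) (I : Set ℝ) (x y : Γ)
    (t : ℝ) : ‖inner ℂ (delta y) (evolution H t (spectralProjection H I (delta x)))‖
      ≤ supAmplitude H I x y := by
  refine le_ciSup (f := fun t : ℝ => ‖inner ℂ (delta y)
    (evolution H t (spectralProjection H I (delta x)))‖) ?_ t
  refine ⟨‖delta y‖ * ‖spectralProjection H I (delta x)‖, ?_⟩
  rintro _ ⟨t, rfl⟩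
  refine (norm_inner_le_norm _ _).trans ?_
  rw [norm_evolution_apply hH]

theorem norm_mul_norm_le_supAmplitude {H : ell2 Γ →L[ℂ] ell2 Γ} (hH : IsSelfAdjoint H) {I : Set ℝ}
    {e : ℝ} (he : e ∈ I) {φ : ell2 Γ} (hφ : H φ = (e : ℂ) • φ) (hφ1 : ‖φ‖ = 1)
    (hsimple : ∀ ψ : ell2 Γ, H ψ = (e : ℂ) • ψ → ∃ k : ℂ, ψ = k • φ) (x y : Γ) :
    ‖φ x‖ * ‖φ y‖ ≤ supAmplitude H I x y := by
  have h := norm_inner_mul_norm_inner_le hH he hφ hφ1 hsimple (delta x) (delta y)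
    (le_supAmplitude hH I x y)
  rwa [norm_inner_symm, inner_delta_left, inner_delta_left] at h

/-- Under dynamical localization the weighted amplitudes `e^{(c-ε) dist(x,·)^ζ} sup_t |…|` are almost
surely summable. -/
theorem DynamicallyLocalized.ae_tsum_ne_top [MetricSpace Γ] [Countable Γ] {Ω : Type*}
    [MeasurableSpace Ω] {ℙ : Measure Ω} {H : Ω → ell2 Γ →L[ℂ] ell2 Γ} {I : Set ℝ} {c C ζ : ℝ}
    (hζ : 0 < ζ) (hC : 0 < C) (hgrowth : SubexponentialGrowth Γ ζ)
    (hDL : DynamicallyLocalized ℙ H I c C ζ) (x : Γ) {ε : ℝ} (hε : 0 < ε) :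
    ∀ᵐ ω ∂ℙ, ∑' y, ENNReal.ofReal
      (Real.exp ((c - ε) * dist x y ^ ζ) * supAmplitude (H ω) I x y) ≠ ∞ := by
  have hm : ∀ y, AEMeasurable (fun ω => ENNReal.ofReal
      (Real.exp ((c - ε) * dist x y ^ ζ) * supAmplitude (H ω) I x y)) ℙ := fun y =>
    (((hDL x y).1.aestronglyMeasurable.aemeasurable).const_mul _).ennreal_ofReal
  have hfin : ∫⁻ ω, ∑' y, ENNReal.ofReal
      (Real.exp ((c - ε) * dist x y ^ ζ) * supAmplitude (H ω) I x y) ∂ℙ ≠ ∞ := by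
    rw [lintegral_tsum hm]
    -- The weight gives up a factor `e^{-ε dist^ζ}` of the expected decay, and this factor is
    -- summable over `y`.
    have hbound : ∀ y, ∫⁻ ω, ENNReal.ofReal
        (Real.exp ((c - ε) * dist x y ^ ζ) * supAmplitude (H ω) I x y) ∂ℙ
        ≤ ENNReal.ofReal C * ENNReal.ofReal (Real.exp (-ε * dist x y ^ ζ)) := by
      intro y
      rw [← ofReal_integral_eq_lintegral_ofReal ((hDL x y).1.const_mul _)
        (.of_forall fun ω => mul_nonneg (Real.exp_pos _).le (supAmplitude_nonneg _ _ _ _)),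
        integral_const_mul, ← ENNReal.ofReal_mul hC.le]
      refine ENNReal.ofReal_le_ofReal ?_
      calc _ ≤ Real.exp ((c - ε) * dist x y ^ ζ) * (C * Real.exp (-c * dist x y ^ ζ)) := by
            gcongr; exact (hDL x y).2
        _ = C * (Real.exp ((c - ε) * dist x y ^ ζ) * Real.exp (-c * dist x y ^ ζ)) := by ring
        _ = _ := by rw [← Real.exp_add]; congr 2; ring
    refine ne_top_of_le_ne_top ?_ (ENNReal.tsum_le_tsum hbound)
    rw [ENNReal.tsum_mul_left]
    exact ENNReal.mul_ne_top ENNReal.ofReal_ne_top (hgrowth.tsum_exp_ne_top hζ x hε)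
  filter_upwards [ae_lt_top' (.tsum hm) hfin] with ω hω using hω.ne

/-- Square-summability leaves only finitely many points where `|φ|` reaches a given positive value,
so the supremum is attained. -/
theorem exists_isLocalizationCenter {φ : ell2 Γ} (hφ : φ ≠ 0) : ∃ x₀, IsLocalizationCenter φ x₀ := by
  obtain ⟨z, hz⟩ : ∃ z, φ z ≠ 0 := by
    by_contra! h
    exact hφ (by ext z; exact h z)
  have hsum : Summable fun x => ‖φ x‖ ^ 2 := by
    simpa using (lp.memℓp φ).summable (by simp)
  have hfin : {x | ‖φ z‖ ≤ ‖φ x‖}.Finite := by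
    have h := hsum.tendsto_cofinite_zero.eventually (gt_mem_nhds (by positivity : 0 < ‖φ z‖ ^ 2))
    rw [eventually_cofinite] at h
    refine h.subset fun x hx => ?_
    simp only [not_lt, Set.mem_ofPred_eq] at hx ⊢
    gcongr
  obtain ⟨x₀, hx₀, hmax⟩ := hfin.exists_maximalFor (fun x => ‖φ x‖) _ ⟨z, le_refl ‖φ z‖⟩
  refine ⟨x₀, ?_, fun b hb => hb ⟨x₀, rfl⟩⟩
  rintro _ ⟨x, rfl⟩
  by_cases hx : ‖φ z‖ ≤ ‖φ x‖
  · exact (le_total ‖φ x‖ ‖φ x₀‖).elim id fun h => hmax hx h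
  · exact (not_le.mp hx).le.trans hx₀

/-- A summable majorant of `|φ(x₀)| |φ(·)|` bounds `|φ|` below at a center of localization, uniformly
in the unit vector `φ`. -/
theorem exists_norm_center_ge {S : Γ → ℝ} (hS : Summable S) :
    ∃ m > 0, ∀ (φ : ell2 Γ) (x₀ : Γ), ‖φ‖ = 1 → IsLocalizationCenter φ x₀ →
      (∀ y, ‖φ x₀‖ * ‖φ y‖ ≤ S y) → m ≤ ‖φ x₀‖ := by
  obtain ⟨s, hs⟩ := ((tendsto_tsum_compl_atTop_zero S).eventually
    (gt_mem_nhds (by norm_num : (0 : ℝ) < 1 / 2))).exists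
  -- At least half of the mass lies in `s`, where `|φ|² ≤ |φ x₀|²`. The `+ 1` keeps the bound
  -- positive even for empty `s`.
  refine ⟨√(1 / (2 * (s.card + 1))), by positivity, fun φ x₀ hφ1 hx₀ hle => ?_⟩
  refine Real.sqrt_le_iff.mpr ⟨norm_nonneg _, ?_⟩
  have hmax : ∀ y, ‖φ y‖ ≤ ‖φ x₀‖ := fun y => hx₀.1 ⟨y, rfl⟩
  have hsum : Summable fun x => ‖φ x‖ ^ 2 := by
    simpa using (lp.memℓp φ).summable (by simp)
  have hnorm : ∑' x, ‖φ x‖ ^ 2 = 1 := by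
    have := lp.norm_rpow_eq_tsum (p := 2) (by simp) φ
    simpa [hφ1] using this.symm
  have hsplit := hsum.sum_add_tsum_compl (s := s)
  have h1 : ∑ x ∈ s, ‖φ x‖ ^ 2 ≤ s.card * ‖φ x₀‖ ^ 2 := by
    rw [← nsmul_eq_mul]
    refine Finset.sum_le_card_nsmul _ _ _ fun y _ => ?_
    gcongr
    exact hmax y
  -- Maximality at the center gives `|φ y|² ≤ |φ x₀| |φ y| ≤ S y`.
  have h2 : ∑' x : ↑((s : Set Γ)ᶜ), ‖φ x‖ ^ 2 ≤ ∑' x : ↑((s : Set Γ)ᶜ), S x := by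
    refine (hsum.subtype _).tsum_le_tsum (fun y => ?_) (hS.subtype _)
    rw [pow_two]
    exact (mul_le_mul_of_nonneg_right (hmax y) (norm_nonneg _)).trans (hle y)
  have h3 : ∑' x : ↑((s : Set Γ)ᶜ), S x < 1 / 2 := hs
  rw [div_le_iff₀ (by positivity)]
  nlinarith [sq_nonneg ‖φ x₀‖]

/-- The uniform decay estimate away from centers of localization, for all unit vectors whose
products `|φ(x₀)| |φ(y)|` are dominated by `S y`. -/
theorem exists_decay_constant [MetricSpace Γ] {S : Γ → ℝ} {κ ζ : ℝ} (hκ : 0 ≤ κ)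
    (hS0 : ∀ y, 0 ≤ S y) (x₀ : Γ)
    (hS : ∑' y, ENNReal.ofReal (Real.exp (κ * dist x₀ y ^ ζ) * S y) ≠ ∞) :
    ∃ D > 0, ∀ φ : ell2 Γ, ‖φ‖ = 1 → IsLocalizationCenter φ x₀ →
      (∀ y, ‖φ x₀‖ * ‖φ y‖ ≤ S y) → ∀ y, ‖φ y‖ ≤ D * Real.exp (-κ * dist x₀ y ^ ζ) := by
  have hw0 : ∀ y, 0 ≤ Real.exp (κ * dist x₀ y ^ ζ) * S y := fun y =>
    mul_nonneg (Real.exp_pos _).le (hS0 y)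
  have hw : Summable fun y => Real.exp (κ * dist x₀ y ^ ζ) * S y := by
    have h := ENNReal.summable_toReal hS
    simpa only [ENNReal.toReal_ofReal (hw0 _)] using h
  have hSsum : Summable S := hw.of_nonneg_of_le hS0 fun y =>
    le_mul_of_one_le_left (hS0 y) (Real.one_le_exp (by positivity))
  obtain ⟨m, hm, hcenter⟩ := exists_norm_center_ge hSsum
  set W := ∑' y, Real.exp (κ * dist x₀ y ^ ζ) * S y with hW
  have hW0 : 0 ≤ W := tsum_nonneg hw0
  -- `W` may vanish; `W + 1` keeps the constant positive.
  refine ⟨(W + 1) / m, by positivity, fun φ hφ1 hx₀ hle y => ?_⟩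
  have h1 := hcenter φ x₀ hφ1 hx₀ hle
  have h2 : Real.exp (κ * dist x₀ y ^ ζ) * S y ≤ W := hw.le_tsum y fun z _ => hw0 z
  have h3 : m * ‖φ y‖ ≤ S y := (mul_le_mul_of_nonneg_right h1 (norm_nonneg _)).trans (hle y)
  have h4 : S y ≤ (W + 1) * Real.exp (-κ * dist x₀ y ^ ζ) := by
    rw [neg_mul, Real.exp_neg, ← div_eq_mul_inv, le_div_iff₀ (Real.exp_pos _)]
    linarith
  rw [div_mul_eq_mul_div, le_div_iff₀ hm]
  linarith

end Decay

end Anderson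

/-! ### The main theorem. -/

theorem theoremt {Γ : Type*} [MetricSpace Γ]
    (G : SimpleGraph Γ) [G.LocallyFinite] (hG : G.Connected)
    (K : ℕ) (hK : ∀ x, G.degree x ≤ K)
    (a b : ℝ) (hab : a < b)
    (μ : MeasureTheory.Measure (Set.Icc a b)) [MeasureTheory.IsProbabilityMeasure μ]
    (hμ : ∀ v, μ {v} = 0)
    (lam : ℝ) (hlam : 0 < lam)
    (I : Set ℝ) (hI : I.OrdConnected)
    (c C ζ : ℝ) (hc : 0 < c) (hC : 0 < C) (hζ : 0 < ζ) (hζ1 : ζ ≤ 1)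
    (hgrowth : Anderson.SubexponentialGrowth Γ ζ)
    (hDL : Anderson.DynamicallyLocalized
      (MeasureTheory.Measure.infinitePi fun _ : Γ => μ)
      (fun ω : Γ → Set.Icc a b => Anderson.hamiltonian G K hK lam ω) I c C ζ) :
    ∀ᵐ ω ∂(MeasureTheory.Measure.infinitePi fun _ : Γ => μ),
      ∀ ε : ℝ, 0 < ε → ∃ D : Γ → ℝ, (∀ x₀, 0 < D x₀) ∧
        ∀ E ∈ I, ∀ φ : Anderson.ell2 Γ,
          Module.End.HasEigenvector
            (Anderson.hamiltonian G K hK lam ω : Module.End ℂ (Anderson.ell2 Γ)) (E : ℂ) φ →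
          (∃ x₀, Anderson.IsLocalizationCenter φ x₀) ∧
          ∀ x₀, Anderson.IsLocalizationCenter φ x₀ →
            ∀ x, ‖φ x‖ ≤ D x₀ * ‖φ‖ * Real.exp (-(c - ε) * dist x x₀ ^ ζ) := by
  have : Countable Γ := hgrowth.countable
  -- The exceptional null set must not depend on `ε`, so only the countably many losses `1 / (n +
  -- 1)` are used.
  have hall : ∀ᵐ ω ∂(Measure.infinitePi fun _ : Γ => μ), ∀ (n : ℕ) (x : Γ),
      ∑' y, ENNReal.ofReal (Real.exp ((c - 1 / ((n : ℝ) + 1)) * dist x y ^ ζ) *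
        Anderson.supAmplitude (Anderson.hamiltonian G K hK lam ω) I x y) ≠ ∞ :=
    ae_all_iff.mpr fun n => ae_all_iff.mpr fun x =>
      hDL.ae_tsum_ne_top hζ hC hgrowth x (by positivity)
  filter_upwards [hall, Anderson.ae_simple_eigenvalues G K hK hlam.ne' μ hμ] with ω hω hsimple ε hε
  -- The minimum with `c` keeps `κ ≥ 0` even when `ε > c`, so that the weights are at least `1` and
  -- the amplitudes themselves are summable.
  obtain ⟨n, hn⟩ := exists_nat_one_div_lt (lt_min hε hc)
  set κ := c - 1 / ((n : ℝ) + 1) with hκ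
  have hκ0 : 0 ≤ κ := by linarith [min_le_right ε c]
  have hκε : c - ε ≤ κ := by linarith [min_le_left ε c]
  have hsa := Anderson.hamiltonian_isSelfAdjoint G K hK lam ω
  choose D hD0 hD using fun x₀ => Anderson.exists_decay_constant hκ0
    (Anderson.supAmplitude_nonneg (Anderson.hamiltonian G K hK lam ω) I x₀) x₀ (hω n x₀)
  refine ⟨D, hD0, fun e he φ hφ => ?_⟩
  have hφ0 : φ ≠ 0 := hφ.2
  have hφe : Anderson.hamiltonian G K hK lam ω φ = (e : ℂ) • φ := hφ.apply_eq_smul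
  refine ⟨Anderson.exists_isLocalizationCenter hφ0, fun x₀ hx₀ x => ?_⟩
  have hn0 : 0 < ‖φ‖ := norm_pos_iff.mpr hφ0
  set χ : Anderson.ell2 Γ := ((‖φ‖⁻¹ : ℝ) : ℂ) • φ with hχ
  have hχx : ∀ y, ‖χ y‖ = ‖φ‖⁻¹ * ‖φ y‖ := fun y => by
    rw [hχ, lp.coeFn_smul, Pi.smul_apply, norm_smul, Complex.norm_real, norm_inv, norm_norm]
  have hχ1 : ‖χ‖ = 1 := by
    rw [hχ, norm_smul, Complex.norm_real, norm_inv, norm_norm, inv_mul_cancel₀ hn0.ne']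
  have hχ0 : χ ≠ 0 := by
    rintro h
    simp [h] at hχ1
  have hχe : Anderson.hamiltonian G K hK lam ω χ = (e : ℂ) • χ := by
    rw [hχ, map_smul, hφe, smul_comm]
  have hχc : Anderson.IsLocalizationCenter χ x₀ := by
    refine ⟨?_, fun b hb => hb ⟨x₀, rfl⟩⟩
    rintro _ ⟨y, rfl⟩
    simp only [hχx]
    gcongr
    exact hx₀.1 ⟨y, rfl⟩
  have h := hD x₀ χ hχ1 hχc (fun y => Anderson.norm_mul_norm_le_supAmplitude hsa he hχe hχ1
    (fun ψ hψ => hsimple e χ ψ hχ0 hχe hψ) x₀ y) x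
  rw [hχx, inv_mul_le_iff₀ hn0] at h
  calc ‖φ x‖ ≤ ‖φ‖ * (D x₀ * Real.exp (-κ * dist x₀ x ^ ζ)) := h
    _ = D x₀ * ‖φ‖ * Real.exp (-κ * dist x x₀ ^ ζ) := by rw [dist_comm]; ring
    _ ≤ D x₀ * ‖φ‖ * Real.exp (-(c - ε) * dist x x₀ ^ ζ) := by
        have := (hD0 x₀).le
        gcongr
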